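/- Let $G$ be a finite simple graph with at least one vertex and let $d$ be its maximum degree. Then $$\mathbf{tw}(G)\le 6d^2\cdot\mathbf{boolw}(G)\qquad\text{and}\qquad \mathbf{boolw}(G)\le \mathbf{tw}(G)+1;$$ that is, if $d\ge 1$, $$\frac{1}{6d^2}\cdot\mathbf{tw}(G)\ \le\ \mathbf{boolw}(G)\ \le\ \mathbf{tw}(G)+1 .$$ Here $\mathbf{tw}(G)$ is the treewidth of $G$, and the boolean-width $\mathbf{boolw}(G)$ is defined as follows. A decomposition tree of $G$ is a pair $(T,\delta)$ where $T$ is a finite tree whose internal nodes all have degree three and $\delta$ is a bijection between $V(G)$ and the leaves of $T$ (the node of a one-node tree counts as a leaf). Removing an edge of $T$ splits the leaves, and hence via $\delta$ the vertices of $G$, into two parts $\{A,\overline A\}$. For $A\subseteq V(G)$ with complement $\overline A$ put $$\mathrm{cut\text{-}bool}(A)=\log_2\bigl|\{N(X)\cap\overline A : X\subseteq A\}\bigr| ,$$ where $N(X)$ is the set of vertices with a neighbour in $X$; this function satisfies $\mathrm{cut\text{-}bool}(A)=\mathrm{cut\text{-}bool}(\overline A)$. The boolean-width of $(T,\delta)$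 is the maximum of $\mathrm{cut\text{-}bool}(A)$ over the cuts $\{A,\overline A\}$ given by the edges of $T$ (it is $0$ if $T$ has no edge), and $\mathbf{boolw}(G)$ is the minimum of this value over all decomposition trees of $G$. -/

import Mathlib

universe u

namespace SimpleGraph

/-- A tree decomposition of a graph `G`: a finite tree with a bag of vertices of `G` at each node,
such that every vertex and every edge lies in a bag, and the nodes whose bags contain a given
vertex form a connected subtree. -/
structure TreeDecomposition {V : Type u} (G : SimpleGraph V) where
  Node : Type
  finite_node : Finite Node
  tree : SimpleGraph Node
  isTree : tree.IsTree
  bag : Node → Set V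
  exists_mem_bag : ∀ v : V, ∃ t, v ∈ bag t
  exists_edge_subset_bag : ∀ v w : V, G.Adj v w → ∃ t, v ∈ bag t ∧ w ∈ bag t
  preconnected_bags : ∀ v : V, (tree.induce {t | v ∈ bag t}).Preconnected

/-- The width of a tree decomposition: the largest size of a bag, minus one. If `G` is finite and
has a vertex, then the largest size is at least one, so that the subtraction does not truncate. -/
noncomputable def TreeDecomposition.width {V : Type u} {G : SimpleGraph V}
    (D : G.TreeDecomposition) : ℕ :=
  (⨆ t : D.Node, (D.bag t).ncard) - 1

/-- The treewidth of a graph: the minimum width of a tree decomposition. -/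
noncomputable def treewidth {V : Type u} (G : SimpleGraph V) : ℕ :=
  ⨅ D : G.TreeDecomposition, D.width

/-- A leaf of a tree: a node of degree one; the only node of a one-node tree (of degree zero)
is a leaf as well. -/
def IsLeafNode {N : Type} (T : SimpleGraph N) (t : N) : Prop :=
  (T.neighborSet t).ncard ≤ 1

/-- A decomposition tree of a graph with vertex set `V`: a finite tree whose internal nodes have
degree three, with a bijection between `V` and the leaves of the tree. -/
structure DecompositionTree (V : Type u) where
  Node : Type
  finite_node : Finite Node
  tree : SimpleGraph Node
  isTree : tree.IsTree
  degree_eq_three : ∀ t, ¬ tree.IsLeafNode t → (tree.neighborSet t).ncard = 3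
  leafEquiv : V ≃ {t : Node // tree.IsLeafNode t}

namespace DecompositionTree

variable {V : Type u} (D : DecompositionTree V)

/-- The side `A` of the cut `{A, Aᶜ}` given by an edge `xy` of the tree: the vertices that are
sent to the leaves of the component containing `x` after the edge `xy` is removed. -/
def side (e : D.tree.Dart) : Set V :=
  {v | (D.tree.deleteEdges {e.edge}).Reachable e.fst (D.leafEquiv v)}

/-- The `f`-width of a decomposition tree: the maximum of `f A` over the cuts `{A, Aᶜ}` given by the
edges of the tree. Both orientations of each edge, hence both `f A` and `f Aᶜ`, are taken into
account; for a symmetric `f` they agree. The width of a one-node tree, which has no edge, is `0`. -/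
noncomputable def width (f : Set V → ℝ) : ℝ :=
  ⨆ e : D.tree.Dart, f (D.side e)

end DecompositionTree

/-- The `f`-width of a graph with vertex set `V`: the minimum `f`-width of a decomposition tree. -/
noncomputable def fWidth {V : Type u} (f : Set V → ℝ) : ℝ :=
  ⨅ D : DecompositionTree V, D.width f

/-- `G.neighborsOutside A X` is `N(X) ∩ Aᶜ`: the vertices outside `A` with a neighbour in `X`. -/
def neighborsOutside {V : Type u} (G : SimpleGraph V) (A X : Set V) : Set V :=
  {w | w ∉ A ∧ ∃ v ∈ X, G.Adj v w}

/-- `cut-bool(A)`: the logarithm in base 2 of the number of sets `N(X) ∩ Aᶜ` with `X ⊆ A`. -/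
noncomputable def cutBool {V : Type u} (G : SimpleGraph V) (A : Set V) : ℝ :=
  Real.logb 2 ({S : Set V | ∃ X ⊆ A, S = G.neighborsOutside A X}.ncard : ℝ)

/-- The boolean-width of a graph. -/
noncomputable def booleanWidth {V : Type u} (G : SimpleGraph V) : ℝ :=
  fWidth G.cutBool

end SimpleGraph

/-! Treewidth is bounded by reusing the tree of a decomposition tree. A vertex `v` is put in every
bag on the paths from its leaf to the leaves of its neighbours. If such a path enters `t` from `s`,
then `v` has a neighbour across the cut of the edge `st`, so apart from at most one vertex placed at
`t` itself, the bag of `t` is covered by at most three inner boundaries. An inner boundary has at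
most `d ^ 2 * cutBool` vertices: a maximal set of boundary vertices with disjoint outside
neighbourhoods has size at most `cutBool`, and two steps from it reach the whole boundary
(`ncard_innerBoundary_le`). This gives the constant 3, better than the 6 required.

Conversely, a cut whose edges are covered by `k` vertices has `cutBool` at most `k`
(`CoversCut.cutBool_le`). Along a tree decomposition with bags of size at most `k`, the vertex set
can be assembled from singletons by disjoint unions, so that the edges leaving each intermediate set
are covered by at most `k` vertices (`assembles_univ`). The binary tree of these unions is the
decomposition tree. -/

theorem Set.ncard_biUnion_le_mul {α β : Type*} {S : Set α} (hS : S.Finite) {f : α → Set β} {n : ℕ}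
    (hf : ∀ a, (f a).ncard ≤ n) : (⋃ a ∈ S, f a).ncard ≤ S.ncard * n := by
  rw [Set.ncard_eq_toFinset_card S hS, ← smul_eq_mul]
  simpa using (hS.toFinset.set_ncard_biUnion_le f).trans
    (Finset.sum_le_card_nsmul _ _ n fun a _ => hf a)

namespace SimpleGraph

/-! ### Upper and lower bounds for `cutBool` -/

section CutBool

variable {V : Type u} {G : SimpleGraph V}

/-- The vertex set `S` meets every edge between `A` and its complement. -/
def CoversCut (G : SimpleGraph V) (A S : Set V) : Prop :=
  ∀ u ∈ A, ∀ w ∉ A, G.Adj u w → u ∈ S ∨ w ∈ S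

theorem CoversCut.compl {A S : Set V} (h : G.CoversCut A S) : G.CoversCut Aᶜ S :=
  fun u hu w hw huw => (h w (not_not.1 hw) u hu huw.symm).symm

/-- The vertices of `A` with a neighbour outside `A`. -/
def innerBoundary (G : SimpleGraph V) (A : Set V) : Set V :=
  {v | v ∈ A ∧ ∃ w ∉ A, G.Adj v w}

variable [Finite V]

theorem cutBool_nonneg (G : SimpleGraph V) (A : Set V) : 0 ≤ G.cutBool A := by
  refine Real.logb_nonneg one_lt_two ?_
  exact_mod_cast (Set.ncard_pos (Set.toFinite {S | ∃ X ⊆ A, S = G.neighborsOutside A X})).2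
    ⟨_, ∅, Set.empty_subset _, rfl⟩

/-- A vertex of `N(X)` outside `A` lies in `S` or has a neighbour in `X ∩ S`. Hence `N(X) ∩ Aᶜ` is
determined by `X ∩ S` and `N(X) ∩ S \ A`, which together form one subset of `S`. -/
theorem CoversCut.cutBool_le {A S : Set V} (h : G.CoversCut A S) : G.cutBool A ≤ S.ncard := by
  have hsub : {N : Set V | ∃ X ⊆ A, N = G.neighborsOutside A X} ⊆
      (fun P => G.neighborsOutside A (P ∩ A) ∪ P \ A) '' 𝒫 S := by
    rintro _ ⟨X, hX, rfl⟩
    refine ⟨X ∩ S ∪ G.neighborsOutside A X ∩ S, ?_, ?_⟩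
    · exact Set.union_subset Set.inter_subset_right Set.inter_subset_right
    · ext w
      simp only [neighborsOutside, Set.mem_union, Set.mem_inter_iff, Set.mem_sdiff,
        Set.mem_ofPred_eq]
      constructor
      · rintro (⟨hw, v, ⟨⟨hv, -⟩ | ⟨hv, -⟩, hvA⟩, hvw⟩ | ⟨⟨hw, -⟩ | ⟨hw, -⟩, hwA⟩)
        · exact ⟨hw, v, hv, hvw⟩
        · exact absurd hvA hv.1
        · exact absurd (hX hw) hwA
        · exact hw
      · rintro ⟨hw, v, hv, hvw⟩
        rcases h v (hX hv) w hw hvw with hS | hS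
        · exact Or.inl ⟨hw, v, ⟨Or.inl ⟨hv, hS⟩, hX hv⟩, hvw⟩
        · exact Or.inr ⟨Or.inr ⟨⟨hw, v, hv, hvw⟩, hS⟩, hw⟩
  have hcard : {N : Set V | ∃ X ⊆ A, N = G.neighborsOutside A X}.ncard ≤ 2 ^ S.ncard :=
    (Set.ncard_le_ncard hsub (Set.toFinite _)).trans
      ((Set.ncard_image_le (Set.toFinite _)).trans_eq (Set.ncard_powerset S))
  have hpos : 0 < {N : Set V | ∃ X ⊆ A, N = G.neighborsOutside A X}.ncard :=
    (Set.ncard_pos (Set.toFinite _)).2 ⟨_, ∅, Set.empty_subset _, rfl⟩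
  rw [cutBool, Real.logb_le_iff_le_rpow one_lt_two (by exact_mod_cast hpos), Real.rpow_natCast]
  exact_mod_cast hcard

/-- Vertices of `A` with pairwise disjoint nonempty neighbourhoods outside `A` give distinct
neighbourhoods for all their subsets. -/
theorem ncard_le_cutBool {A M : Set V} (hM : M ⊆ G.innerBoundary A)
    (hdisj : ∀ u ∈ M, ∀ v ∈ M, ∀ w ∉ A, G.Adj u w → G.Adj v w → u = v) :
    (M.ncard : ℝ) ≤ G.cutBool A := by
  have hinj : Set.InjOn (G.neighborsOutside A) (𝒫 M) := by
    have key : ∀ X ⊆ M, ∀ Y ⊆ M, G.neighborsOutside A X = G.neighborsOutside A Y → X ⊆ Y := by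
      intro X hX Y hY hXY x hx
      obtain ⟨-, w, hw, hxw⟩ := hM (hX hx)
      have : w ∈ G.neighborsOutside A Y := hXY ▸ ⟨hw, x, hx, hxw⟩
      obtain ⟨-, y, hy, hyw⟩ := this
      exact hdisj x (hX hx) y (hY hy) w hw hxw hyw ▸ hy
    exact fun X hX Y hY h => (key X hX Y hY h).antisymm (key Y hY X hX h.symm)
  have hcard : 2 ^ M.ncard ≤ {N : Set V | ∃ X ⊆ A, N = G.neighborsOutside A X}.ncard := by
    rw [← Set.ncard_powerset, ← hinj.ncard_image]
    refine Set.ncard_le_ncard ?_ (Set.toFinite _)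
    rintro _ ⟨X, hX, rfl⟩
    exact ⟨X, fun x hx => (hM (hX hx)).1, rfl⟩
  rw [cutBool, Real.le_logb_iff_rpow_le one_lt_two, Real.rpow_natCast]
  · exact_mod_cast hcard
  · exact_mod_cast (pow_pos two_pos _).trans_le hcard

theorem ncard_innerBoundary_le {d : ℕ} (hd : ∀ v, (G.neighborSet v).ncard ≤ d) (A : Set V) :
    ((G.innerBoundary A).ncard : ℝ) ≤ (d : ℝ) ^ 2 * G.cutBool A := by
  obtain ⟨M, hM⟩ := (Set.toFinite {M : Set V | M ⊆ G.innerBoundary A ∧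
    ∀ u ∈ M, ∀ v ∈ M, ∀ w ∉ A, G.Adj u w → G.Adj v w → u = v}).exists_maximal
      ⟨∅, Set.empty_subset _, fun u hu => hu.elim⟩
  have hsub : G.innerBoundary A ⊆ ⋃ u ∈ M, ⋃ w ∈ G.neighborSet u, G.neighborSet w := by
    intro v hv
    simp only [Set.mem_iUnion, mem_neighborSet, exists_prop]
    by_contra! hcon
    have hnot : ∀ u ∈ M, ∀ w, G.Adj u w → ¬ G.Adj v w := fun u hu w huw hvw =>
      hcon u hu w huw hvw.symm
    -- Having no common neighbour with any member of `M`, `v` may be added, so by maximality `v ∈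
    -- M`. But then `v` reaches itself in two steps through an outside neighbour.
    have hins : insert v M ⊆ M := by
      refine hM.2 ⟨Set.insert_subset hv hM.1.1, ?_⟩ (Set.subset_insert _ _)
      rintro a (rfl | ha) b (rfl | hb) w hw haw hbw
      · rfl
      · exact (hnot b hb w hbw haw).elim
      · exact (hnot a ha w haw hbw).elim
      · exact hM.1.2 a ha b hb w hw haw hbw
    obtain ⟨-, w, -, hvw⟩ := hv
    exact hnot v (hins (Set.mem_insert _ _)) w hvw hvw
  have hcard : (G.innerBoundary A).ncard ≤ M.ncard * (d * d) :=
    (Set.ncard_le_ncard hsub (Set.toFinite _)).trans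
      (Set.ncard_biUnion_le_mul (Set.toFinite _) fun u =>
        (Set.ncard_biUnion_le_mul (Set.toFinite _) hd).trans (Nat.mul_le_mul_right _ (hd u)))
  calc ((G.innerBoundary A).ncard : ℝ) ≤ M.ncard * (d * d) := by exact_mod_cast hcard
    _ = (d : ℝ) ^ 2 * M.ncard := by ring
    _ ≤ _ := by gcongr; exact ncard_le_cutBool hM.1.1 hM.1.2

end CutBool

/-! ### From a decomposition tree to a tree decomposition -/

theorem IsTree.not_reachable_deleteEdges {N : Type*} {T : SimpleGraph N} (hT : T.IsTree) {x y : N}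
    (h : T.Adj x y) : ¬ (T.deleteEdges {s(x, y)}).Reachable x y :=
  isBridge_iff.1 (isAcyclic_iff_forall_adj_isBridge.1 hT.isAcyclic h)

/-- A path through `t`, not starting at `t`, enters `t` along an edge that separates the rest of
the path from its start. -/
theorem Walk.IsPath.exists_adj_reachable_deleteEdges {N : Type*} {T : SimpleGraph N} {a b t : N}
    {p : T.Walk a b} (hp : p.IsPath) (ht : t ∈ p.support) (hta : t ≠ a) :
    ∃ s, T.Adj s t ∧ (T.deleteEdges {s(s, t)}).Reachable s a ∧
      (T.deleteEdges {s(s, t)}).Reachable t b := by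
  induction p with
  | nil => simp at ht; exact absurd ht hta
  | @cons a c b h p ih =>
    rw [Walk.cons_isPath_iff] at hp
    by_cases htc : t = c
    · subst htc
      refine ⟨a, h, Reachable.refl _, ⟨p.toDeleteEdges _ fun e he hes => hp.2 ?_⟩⟩
      rw [Set.mem_singleton_iff.1 hes] at he
      exact p.fst_mem_support_of_mem_edges he
    · rw [Walk.support_cons, List.mem_cons] at ht
      obtain ⟨s, hst, hs, hb⟩ := ih hp.1 (ht.resolve_left hta) htc
      refine ⟨s, hst, hs.trans (Adj.reachable ?_), hb⟩
      rw [deleteEdges_adj]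
      refine ⟨h.symm, fun heq => ?_⟩
      rcases Sym2.eq_iff.1 (Set.mem_singleton_iff.1 heq) with ⟨-, h2⟩ | ⟨h1, -⟩
      · exact hta h2.symm
      · exact htc h1.symm

namespace DecompositionTree

variable {V : Type u} (D : DecompositionTree V) (G : SimpleGraph V)

/-- The vertices `v` for which `t` lies on the path between the leaves of `v` and of some vertex
that is equal or adjacent to `v`. -/
def pathBag (t : D.Node) : Set V :=
  {v | ∃ w, (w = v ∨ G.Adj v w) ∧
    ∃ p : D.tree.Walk (D.leafEquiv v) (D.leafEquiv w), p.IsPath ∧ t ∈ p.support}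

theorem leaf_mem_pathBag {v w : V} (h : w = v ∨ G.Adj v w) : v ∈ D.pathBag G (D.leafEquiv w) := by
  obtain ⟨p, hp, -⟩ := D.isTree.existsUnique_path (D.leafEquiv v) (D.leafEquiv w)
  exact ⟨w, h, p, hp, p.end_mem_support⟩

theorem preconnected_pathBag (v : V) : (D.tree.induce {t | v ∈ D.pathBag G t}).Preconnected := by
  have hv : v ∈ D.pathBag G (D.leafEquiv v) := D.leaf_mem_pathBag G (Or.inl rfl)
  have key : ∀ t (ht : v ∈ D.pathBag G t),
      (D.tree.induce {t | v ∈ D.pathBag G t}).Reachable ⟨D.leafEquiv v, hv⟩ ⟨t, ht⟩ := by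
    classical
    rintro t ⟨w, hw, p, hp, ht⟩
    exact Walk.reachable ((p.takeUntil t ht).induce {t | v ∈ D.pathBag G t} fun x hx =>
      ⟨w, hw, p, hp, p.support_takeUntil_subset_support ht hx⟩)
  exact fun s t => (key s.1 s.2).symm.trans (key t.1 t.2)

/-- The tree decomposition of a graph on the tree of a decomposition tree. -/
def toTreeDecomposition : G.TreeDecomposition where
  Node := D.Node
  finite_node := D.finite_node
  tree := D.tree
  isTree := D.isTree
  bag := D.pathBag G
  exists_mem_bag _ := ⟨_, D.leaf_mem_pathBag G (Or.inl rfl)⟩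
  exists_edge_subset_bag v _ h :=
    ⟨D.leafEquiv v, D.leaf_mem_pathBag G (Or.inl rfl), D.leaf_mem_pathBag G (Or.inr h.symm)⟩
  preconnected_bags := D.preconnected_pathBag G

/-- The path enters `t` along an edge `st` that separates the leaf of `v` from that of `w`. So `w`
lies outside the side of `v`; in particular `w ≠ v`, and `w` is a neighbour across the cut. -/
theorem pathBag_subset (t : D.Node) : D.pathBag G t ⊆ {v | (D.leafEquiv v : D.Node) = t} ∪
    ⋃ s ∈ D.tree.neighborSet t, {v | ∃ h : D.tree.Adj s t,
      v ∈ G.innerBoundary (D.side ⟨(s, t), h⟩)} := by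
  rintro v ⟨w, hw, p, hp, ht⟩
  by_cases hvt : t = D.leafEquiv v
  · exact Or.inl hvt.symm
  right
  obtain ⟨s, hst, hs, hb⟩ := hp.exists_adj_reachable_deleteEdges ht hvt
  have hwn : w ∉ D.side ⟨(s, t), hst⟩ := fun h =>
    D.isTree.not_reachable_deleteEdges hst (Reachable.trans h hb.symm)
  simp only [Set.mem_iUnion, mem_neighborSet, exists_prop]
  refine ⟨s, hst.symm, hst, hs, w, hwn, hw.resolve_left ?_⟩
  rintro rfl
  exact hwn hs

variable {G}

theorem ncard_neighborSet_le_three (t : D.Node) : (D.tree.neighborSet t).ncard ≤ 3 := by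
  by_cases h : D.tree.IsLeafNode t
  · exact le_trans h (by norm_num)
  · exact (D.degree_eq_three t h).le

theorem le_width (f : Set V → ℝ) (e : D.tree.Dart) : f (D.side e) ≤ D.width f := by
  have := D.finite_node
  have : Finite D.tree.Dart := Finite.of_injective _ Dart.toProd_injective
  exact le_ciSup (f := fun e => f (D.side e)) (Set.finite_range _).bddAbove e

theorem width_nonneg [Finite V] : 0 ≤ D.width G.cutBool :=
  Real.iSup_nonneg fun _ => G.cutBool_nonneg _

theorem ncard_pathBag_le [Finite V] {d : ℕ} (hd : ∀ v, (G.neighborSet v).ncard ≤ d) (t : D.Node) :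
    ((D.pathBag G t).ncard : ℝ) ≤ 3 * (d : ℝ) ^ 2 * D.width G.cutBool + 1 := by
  have := D.finite_node
  have hb : 0 ≤ (d : ℝ) ^ 2 * D.width G.cutBool := mul_nonneg (sq_nonneg _) D.width_nonneg
  have hleaf : {v | (D.leafEquiv v : D.Node) = t}.ncard ≤ 1 :=
    (Set.ncard_le_one (Set.toFinite _)).2 fun a ha b hb =>
      D.leafEquiv.injective (Subtype.ext (Eq.trans ha (Eq.symm hb)))
  -- The bound is needed for every node `s`; for non-neighbours of `t` the set is empty. The floor
  -- turns the real bound into one on cardinalities.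
  have hside : ∀ s, {v | ∃ h : D.tree.Adj s t, v ∈ G.innerBoundary (D.side ⟨(s, t), h⟩)}.ncard ≤
      ⌊(d : ℝ) ^ 2 * D.width G.cutBool⌋₊ := by
    intro s
    rw [Nat.le_floor_iff hb]
    by_cases h : D.tree.Adj s t
    · simp only [h, exists_true_left]
      exact (ncard_innerBoundary_le hd _).trans
        (mul_le_mul_of_nonneg_left (D.le_width _ _) (sq_nonneg _))
    · simpa [h] using hb
  have hcard : (D.pathBag G t).ncard ≤ 1 + 3 * ⌊(d : ℝ) ^ 2 * D.width G.cutBool⌋₊ := by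
    refine (Set.ncard_le_ncard (D.pathBag_subset G t) (Set.toFinite _)).trans
      ((Set.ncard_union_le _ _).trans (add_le_add hleaf ?_))
    exact (Set.ncard_biUnion_le_mul (Set.toFinite _) hside).trans
      (Nat.mul_le_mul_right _ (D.ncard_neighborSet_le_three t))
  have hcard' : ((D.pathBag G t).ncard : ℝ) ≤
      1 + 3 * (⌊(d : ℝ) ^ 2 * D.width G.cutBool⌋₊ : ℝ) := by exact_mod_cast hcard
  linarith [Nat.floor_le hb]

theorem treewidth_le [Finite V] {d : ℕ} (hd : ∀ v, (G.neighborSet v).ncard ≤ d) :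
    (G.treewidth : ℝ) ≤ 3 * (d : ℝ) ^ 2 * D.width G.cutBool := by
  have hne : Nonempty D.Node := D.isTree.connected.nonempty
  have hb : 0 ≤ 3 * (d : ℝ) ^ 2 * D.width G.cutBool :=
    mul_nonneg (by positivity) D.width_nonneg
  have hle : (⨆ t, (D.pathBag G t).ncard) ≤ ⌊3 * (d : ℝ) ^ 2 * D.width G.cutBool⌋₊ + 1 := by
    refine ciSup_le fun t => ?_
    rw [← Nat.floor_add_one hb]
    exact Nat.le_floor (D.ncard_pathBag_le hd t)
  have htw : G.treewidth ≤ (D.toTreeDecomposition G).width := ciInf_le (OrderBot.bddBelow _) _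
  refine le_trans ?_ (Nat.floor_le hb)
  exact_mod_cast htw.trans (Nat.sub_le_iff_le_add.2 hle)

end DecompositionTree

/-! ### Branches of a tree at an edge -/

section Branch

variable {N : Type*} {T : SimpleGraph N} {s t p u w : N}

/-- The nodes on the side of `s` when the edge `st` is removed. -/
def branch (T : SimpleGraph N) (s t : N) : Set N :=
  {u | (T.deleteEdges {s(s, t)}).Reachable s u}

theorem self_mem_branch : s ∈ T.branch s t := Reachable.refl s

theorem eq_of_adj_of_mem_branch (hst : s ≠ t) (ht : t ∉ T.branch s t) (hu : u ∈ T.branch s t)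
    (hw : w ∉ T.branch s t) (h : T.Adj u w) : u = s ∧ w = t := by
  by_cases he : s(u, w) = s(s, t)
  · rcases Sym2.eq_iff.1 he with h | ⟨rfl, rfl⟩
    · exact h
    · exact absurd hu ht
  · exact absurd (Reachable.trans hu (Adj.reachable (deleteEdges_adj.2 ⟨h, he⟩))) hw

theorem Connected.mem_branch_or (hT : T.Connected) (s t u : N) :
    u ∈ T.branch s t ∨ u ∈ T.branch t s := by
  by_contra! hu
  obtain ⟨q⟩ := hT.preconnected s u
  obtain ⟨e, -, h1, h2⟩ := q.exists_boundary_dart (T.branch s t ∪ T.branch t s)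
    (Or.inl self_mem_branch) (by simpa using hu)
  refine h2 ?_
  by_cases he : s(e.fst, e.snd) = s(s, t)
  · rcases Sym2.eq_iff.1 he with ⟨-, h⟩ | ⟨-, h⟩
    · exact Or.inr (h ▸ self_mem_branch)
    · exact Or.inl (h ▸ self_mem_branch)
  · refine h1.imp (fun h => Reachable.trans h (Adj.reachable (deleteEdges_adj.2 ⟨e.adj, he⟩)))
      (fun h => Reachable.trans h (Adj.reachable (deleteEdges_adj.2 ⟨e.adj, ?_⟩)))
    rwa [Sym2.eq_swap (a := t)]

namespace IsTree

theorem notMem_branch (hT : T.IsTree) (h : T.Adj s t) : t ∉ T.branch s t :=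
  hT.not_reachable_deleteEdges h

theorem disjoint_branch (hT : T.IsTree) (h : T.Adj s t) :
    Disjoint (T.branch s t) (T.branch t s) := by
  refine Set.disjoint_left.2 fun u hu hu' => hT.not_reachable_deleteEdges h ?_
  rw [branch, Sym2.eq_swap] at hu'
  exact Reachable.trans hu (Reachable.symm hu')

theorem exists_mem_branch (hT : T.IsTree) (h : u ≠ t) : ∃ s, T.Adj s t ∧ u ∈ T.branch s t := by
  obtain ⟨q, hq, -⟩ := hT.existsUnique_path u t
  obtain ⟨s, hst, hs, -⟩ := hq.exists_adj_reachable_deleteEdges q.end_mem_support h.symm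
  exact ⟨s, hst, hs⟩

/-- The only way out of the branch of `t` away from `p` starts at `t`, and `t` cannot be reached
from `s` without the edge `st`. The strictness drives the induction in `assembles_inside`. -/
theorem branch_ssubset (hT : T.IsTree) (hs : T.Adj s t) (hp : T.Adj t p) (hsp : s ≠ p) :
    T.branch s t ⊂ T.branch t p := by
  classical
  have hcross : ∀ {a b}, a ∈ T.branch t p → b ∉ T.branch t p → T.Adj a b → a = t ∧ b = p :=
    eq_of_adj_of_mem_branch hp.ne (hT.notMem_branch hp)
  refine ⟨fun u hu => ?_, fun h => hT.notMem_branch hs (h self_mem_branch)⟩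
  by_contra hu'
  have hst : s ∈ T.branch t p := by
    by_contra hs'
    exact hsp (hcross self_mem_branch hs' hs.symm).2
  obtain ⟨q⟩ := hu
  obtain ⟨e, he, h1, h2⟩ := q.exists_boundary_dart (T.branch t p) hst hu'
  have hmem := q.dart_fst_mem_support_of_mem_darts he
  rw [(hcross h1 h2 (deleteEdges_adj.1 e.adj).1).1] at hmem
  exact hT.notMem_branch hs (q.takeUntil t hmem).reachable

theorem disjoint_branch_of_ne (hT : T.IsTree) (hs : T.Adj s t) (hp : T.Adj p t) (hsp : s ≠ p) :
    Disjoint (T.branch s t) (T.branch p t) :=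
  (hT.disjoint_branch hp.symm).mono_left (hT.branch_ssubset hs hp.symm hsp).1

end IsTree
end Branch

/-! ### Assembling the vertex set along a tree decomposition -/

section Assembles

variable {V : Type u} {P : Set V → Prop}

/-- The sets that can be assembled from singletons by disjoint unions, passing only through sets
with the property `P`. -/
inductive Assembles (P : Set V → Prop) : Set V → Prop
  | singleton (v : V) : P {v} → Assembles P {v}
  | union {A B : Set V} : Assembles P A → Assembles P B → Disjoint A B → P (A ∪ B) →
      Assembles P (A ∪ B)

theorem Assembles.prop {A : Set V} (h : Assembles P A) : P A := by
  cases h <;> assumption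

/-- The empty set cannot be assembled, yet a branch may hold no vertex of its own; such parts are
skipped. -/
theorem Assembles.union_of_nonempty {A B : Set V} (hA : A.Nonempty → Assembles P A)
    (hB : B.Nonempty → Assembles P B) (h : Disjoint A B) (hP : P (A ∪ B))
    (hne : (A ∪ B).Nonempty) : Assembles P (A ∪ B) := by
  rcases A.eq_empty_or_nonempty with rfl | hA'
  · rw [Set.empty_union] at hne ⊢
    exact hB hne
  · rcases B.eq_empty_or_nonempty with rfl | hB'
    · rw [Set.union_empty] at hne ⊢
      exact hA hne
    · exact .union (hA hA') (hB hB') h hP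

end Assembles

namespace TreeDecomposition

variable {V : Type u} {G : SimpleGraph V} (D : G.TreeDecomposition) {s t : D.Node}

/-- The vertices all of whose bags lie in the branch of `s` away from `t`. -/
def inside (s t : D.Node) : Set V :=
  {v | ∀ u, v ∈ D.bag u → u ∈ D.tree.branch s t}

variable {D}

/-- The nodes whose bags contain `v` are connected and lie on both sides of the edge `st`, so both
its ends are among them. -/
theorem mem_bag_of_notMem_inside (hst : D.tree.Adj s t) {v : V} {u : D.Node} (hu : v ∈ D.bag u)
    (hus : u ∈ D.tree.branch s t) (hv : v ∉ D.inside s t) : v ∈ D.bag s ∧ v ∈ D.bag t := by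
  simp only [inside, Set.mem_ofPred_eq, not_forall] at hv
  obtain ⟨w, hw, hws⟩ := hv
  obtain ⟨q⟩ := D.preconnected_bags v ⟨u, hu⟩ ⟨w, hw⟩
  obtain ⟨e, -, h1, h2⟩ := q.exists_boundary_dart (Subtype.val ⁻¹' D.tree.branch s t) hus hws
  obtain ⟨hs, ht⟩ := eq_of_adj_of_mem_branch hst.ne (D.isTree.notMem_branch hst) h1 h2 e.adj
  exact ⟨hs ▸ e.fst.2, ht ▸ e.snd.2⟩

theorem notMem_bag_of_mem_inside (hst : D.tree.Adj s t) {v : V} (hv : v ∈ D.inside s t) :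
    v ∉ D.bag t :=
  fun h => D.isTree.notMem_branch hst (hv t h)

theorem exists_mem_inside {v : V} (hv : v ∉ D.bag t) :
    ∃ s, D.tree.Adj s t ∧ v ∈ D.inside s t := by
  obtain ⟨u, hu⟩ := D.exists_mem_bag v
  obtain ⟨s, hst, hus⟩ := D.isTree.exists_mem_branch (u := u) (t := t) (by rintro rfl; exact hv hu)
  refine ⟨s, hst, ?_⟩
  by_contra h
  exact hv (mem_bag_of_notMem_inside hst hu hus h).2

theorem disjoint_inside {p : D.Node} (hs : D.tree.Adj s t) (hp : D.tree.Adj p t) (hsp : s ≠ p) :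
    Disjoint (D.inside s t) (D.inside p t) := by
  refine Set.disjoint_left.2 fun v hv hv' => ?_
  obtain ⟨u, hu⟩ := D.exists_mem_bag v
  exact Set.disjoint_left.1 (D.isTree.disjoint_branch_of_ne hs hp hsp) (hv u hu) (hv' u hu)

/-- A union of vertices of a bag and of sets hanging off it is cut off from the rest by the bag. -/
theorem coversCut_bag {F : Set D.Node} (hF : F ⊆ D.tree.neighborSet t) {B : Set V}
    (hB : B ⊆ D.bag t) : G.CoversCut (B ∪ ⋃ s ∈ F, D.inside s t) (D.bag t) := by
  rintro u (hu | hu) w hw huw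
  · exact Or.inl (hB hu)
  · simp only [Set.mem_iUnion, exists_prop] at hu
    obtain ⟨s, hs, hu⟩ := hu
    obtain ⟨x, hux, hwx⟩ := D.exists_edge_subset_bag u w huw
    refine Or.inr (mem_bag_of_notMem_inside (Adj.symm (hF hs)) hwx (hu x hux) fun h => hw ?_).2
    exact Or.inr (Set.mem_biUnion hs h)

variable [Finite V] {k : ℕ}

theorem assembles_bag_union (hk : (D.bag t).ncard ≤ k) (hk1 : 1 ≤ k) {F : Set D.Node}
    (hF : F ⊆ D.tree.neighborSet t) {B : Set V} (hB : B ⊆ D.bag t)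
    (hass : ∀ s ∈ F, (D.inside s t).Nonempty →
      Assembles (fun A => ∃ S : Set V, S.ncard ≤ k ∧ G.CoversCut A S) (D.inside s t))
    (hne : (B ∪ ⋃ s ∈ F, D.inside s t).Nonempty) :
    Assembles (fun A => ∃ S : Set V, S.ncard ≤ k ∧ G.CoversCut A S)
      (B ∪ ⋃ s ∈ F, D.inside s t) := by
  have := D.finite_node
  -- Bag vertices are split off one at a time, then the hanging sets. Each remainder has the same
  -- shape, so the same bag covers its cut, whatever the degree of `t`.
  induction B, Set.toFinite B using Set.Finite.induction_on with
  | empty =>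
    induction F, Set.toFinite F using Set.Finite.induction_on with
    | empty => simp at hne
    | @insert s F hs _ ih =>
      have hcov := coversCut_bag hF hB
      have hF' := (Set.subset_insert s F).trans hF
      have heq : ∅ ∪ ⋃ x ∈ insert s F, D.inside x t = D.inside s t ∪ (∅ ∪ ⋃ x ∈ F, D.inside x t) := by
        simp only [Set.empty_union, Set.biUnion_insert]
      rw [heq] at hne hcov ⊢
      refine Assembles.union_of_nonempty (hass s (Set.mem_insert _ _))
        (ih hF' fun x hx => hass x (Set.mem_insert_of_mem _ hx)) ?_ ⟨_, hk, hcov⟩ hne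
      rw [Set.empty_union, Set.disjoint_iUnion₂_right]
      exact fun x hx => disjoint_inside (Adj.symm (hF (Set.mem_insert _ _))) (Adj.symm (hF' hx))
        (by rintro rfl; exact hs hx)
  | @insert v B hv _ ih =>
    have hcov := coversCut_bag hF hB
    have hB' := (Set.subset_insert v B).trans hB
    rw [Set.insert_eq, Set.union_assoc] at hne hcov ⊢
    refine Assembles.union_of_nonempty (fun _ => .singleton v ⟨{v}, by simpa using hk1, ?_⟩)
      (ih hB') ?_ ⟨_, hk, hcov⟩ hne
    · exact fun u hu _ _ _ => Or.inl hu
    · rw [Set.disjoint_singleton_left]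
      rintro (h | h)
      · exact hv h
      · simp only [Set.mem_iUnion, exists_prop] at h
        obtain ⟨s, hs, h⟩ := h
        exact notMem_bag_of_mem_inside (Adj.symm (hF hs)) h (hB (Set.mem_insert _ _))

/-- Induction on the size of the branch: the set consists of its vertices in the bag of `s` and of
the sets hanging off the other neighbours of `s`, whose branches are smaller. -/
theorem assembles_inside (hk : ∀ t, (D.bag t).ncard ≤ k) (hk1 : 1 ≤ k) (hst : D.tree.Adj s t)
    (hne : (D.inside s t).Nonempty) :
    Assembles (fun A => ∃ S : Set V, S.ncard ≤ k ∧ G.CoversCut A S) (D.inside s t) := by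
  have := D.finite_node
  induction hn : (D.tree.branch s t).ncard using Nat.strong_induction_on generalizing s t with
  | _ n ih =>
    have heq : D.inside s t = (D.bag s ∩ D.inside s t) ∪
        ⋃ p ∈ D.tree.neighborSet s \ {t}, D.inside p s := by
      ext v
      simp only [Set.mem_union, Set.mem_inter_iff, Set.mem_iUnion, exists_prop]
      constructor
      · intro hv
        by_cases hvs : v ∈ D.bag s
        · exact Or.inl ⟨hvs, hv⟩
        · obtain ⟨p, hps, hvp⟩ := exists_mem_inside hvs
          refine Or.inr ⟨p, ⟨hps.symm, ?_⟩, hvp⟩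
          rintro rfl
          obtain ⟨u, hu⟩ := D.exists_mem_bag v
          exact Set.disjoint_left.1 (D.isTree.disjoint_branch hst) (hv u hu) (hvp u hu)
      · rintro (hv | ⟨p, ⟨hps, hpt⟩, hv⟩)
        · exact hv.2
        · exact fun u hu => (D.isTree.branch_ssubset (Adj.symm hps) hst hpt).1 (hv u hu)
    rw [heq] at hne ⊢
    refine assembles_bag_union (hk s) hk1 Set.sdiff_subset Set.inter_subset_left ?_ hne
    rintro p ⟨hps, hpt⟩ hp
    refine ih _ ?_ (Adj.symm hps) hp rfl
    exact hn ▸ Set.ncard_lt_ncard (D.isTree.branch_ssubset (Adj.symm hps) hst hpt) (Set.toFinite _)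

theorem assembles_univ [Nonempty V] (hk : ∀ t, (D.bag t).ncard ≤ k) (hk1 : 1 ≤ k) :
    Assembles (fun A => ∃ S : Set V, S.ncard ≤ k ∧ G.CoversCut A S) Set.univ := by
  obtain ⟨t⟩ : Nonempty D.Node := D.isTree.connected.nonempty
  have heq : Set.univ = D.bag t ∪ ⋃ s ∈ D.tree.neighborSet t, D.inside s t := by
    refine (Set.eq_univ_of_forall fun v => ?_).symm
    by_cases hv : v ∈ D.bag t
    · exact Or.inl hv
    · obtain ⟨s, hst, hvs⟩ := exists_mem_inside hv
      exact Or.inr (Set.mem_biUnion hst.symm hvs)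
  rw [heq]
  refine assembles_bag_union (hk t) hk1 subset_rfl subset_rfl
    (fun s hs => assembles_inside hk hk1 (Adj.symm hs)) (heq ▸ Set.univ_nonempty)

end TreeDecomposition

/-! ### Gluing trees along half-edges -/

section Glue

variable {N M : Type*} (T : SimpleGraph N) (U : SimpleGraph M) (a : N) (r : M)

/-- The disjoint union of two graphs with an additional edge between `a` and `r`. -/
def glue : SimpleGraph (N ⊕ M) where
  Adj
    | .inl x, .inl y => T.Adj x y
    | .inr x, .inr y => U.Adj x y
    | .inl x, .inr y => x = a ∧ y = r
    | .inr y, .inl x => x = a ∧ y = r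
  symm := ⟨by
    rintro (x | x) (y | y) h
    exacts [T.adj_symm h, h, h, U.adj_symm h]⟩
  loopless := ⟨by
    rintro (x | x) h
    exacts [T.irrefl h, U.irrefl h]⟩

variable {T U a r}

theorem Connected.glue (hT : T.Connected) (hU : U.Connected) : (T.glue U a r).Connected := by
  have hl : ∀ x, (T.glue U a r).Reachable (.inl a) (.inl x) := fun x =>
    (hT.preconnected a x).map (⟨Sum.inl, id⟩ : T →g T.glue U a r)
  have hr : ∀ x, (T.glue U a r).Reachable (.inr r) (.inr x) := fun x =>
    (hU.preconnected r x).map (⟨Sum.inr, id⟩ : U →g T.glue U a r)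
  have har : (T.glue U a r).Reachable (.inl a) (.inr r) := Adj.reachable ⟨rfl, rfl⟩
  have key : ∀ z, (T.glue U a r).Reachable (.inl a) z := by
    rintro (x | x)
    exacts [hl x, har.trans (hr x)]
  exact connected_iff_exists_forall_reachable _ |>.2 ⟨_, key⟩

theorem ncard_neighborSet_glue_inl [Finite N] [DecidableEq N] (x : N) :
    ((T.glue U a r).neighborSet (.inl x)).ncard =
      (T.neighborSet x).ncard + (Pi.single a 1 : N → ℕ) x := by
  by_cases hx : x = a
  · subst hx
    have h : (T.glue U x r).neighborSet (.inl x) = insert (.inr r) (Sum.inl '' T.neighborSet x) := by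
      ext (y | y) <;> simp [glue]
    rw [h, Set.ncard_insert_of_notMem (by simp) (Set.toFinite _),
      Set.ncard_image_of_injective _ Sum.inl_injective, Pi.single_eq_same]
  · have h : (T.glue U a r).neighborSet (.inl x) = Sum.inl '' T.neighborSet x := by
      ext (y | y) <;> simp [glue, hx]
    rw [h, Set.ncard_image_of_injective _ Sum.inl_injective, Pi.single_eq_of_ne hx, add_zero]

theorem ncard_neighborSet_glue_inr [Finite M] [DecidableEq M] (x : M) :
    ((T.glue U a r).neighborSet (.inr x)).ncard =
      (U.neighborSet x).ncard + (Pi.single r 1 : M → ℕ) x := by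
  by_cases hx : x = r
  · subst hx
    have h : (T.glue U a x).neighborSet (.inr x) = insert (.inl a) (Sum.inr '' U.neighborSet x) := by
      ext (y | y) <;> simp [glue]
    rw [h, Set.ncard_insert_of_notMem (by simp) (Set.toFinite _),
      Set.ncard_image_of_injective _ Sum.inr_injective, Pi.single_eq_same]
  · have h : (T.glue U a r).neighborSet (.inr x) = Sum.inr '' U.neighborSet x := by
      ext (y | y) <;> simp [glue, hx]
    rw [h, Set.ncard_image_of_injective _ Sum.inr_injective, Pi.single_eq_of_ne hx, add_zero]

end Glue

section EdgeCut

variable {N : Type*} {T : SimpleGraph N} {x y : N} {C : Set N}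

/-- `C` contains `x` but not `y`, and `xy` is the only edge that leaves `C`. -/
structure IsEdgeCut (T : SimpleGraph N) (x y : N) (C : Set N) : Prop where
  mem : x ∈ C
  notMem : y ∉ C
  eq_of_adj : ∀ a ∈ C, ∀ b ∉ C, T.Adj a b → a = x ∧ b = y

theorem IsEdgeCut.branch_subset (h : T.IsEdgeCut x y C) : T.branch x y ⊆ C := by
  rintro u ⟨q⟩
  by_contra hu
  obtain ⟨e, -, h1, h2⟩ := q.exists_boundary_dart C h.mem hu
  obtain ⟨hadj, hne⟩ := deleteEdges_adj.1 e.adj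
  obtain ⟨hx, hy⟩ := h.eq_of_adj _ h1 _ h2 hadj
  exact hne (by rw [hx, hy]; rfl)

theorem IsEdgeCut.compl (h : T.IsEdgeCut x y C) : T.IsEdgeCut y x Cᶜ :=
  ⟨h.notMem, not_not.2 h.mem, fun a ha b hb hab =>
    (h.eq_of_adj b (not_not.1 hb) a ha hab.symm).symm⟩

theorem IsEdgeCut.branch_eq (h : T.IsEdgeCut x y C) (hT : T.Connected) : T.branch x y = C :=
  h.branch_subset.antisymm fun u hu =>
    (hT.mem_branch_or x y u).resolve_right fun hu' => h.compl.branch_subset hu' hu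

theorem Connected.isTree_of_isEdgeCut (hT : T.Connected)
    (h : ∀ x y, T.Adj x y → ∃ C, T.IsEdgeCut x y C) : T.IsTree := by
  refine ⟨hT, isAcyclic_iff_forall_adj_isBridge.2 fun x y hxy => ?_⟩
  obtain ⟨C, hC⟩ := h x y hxy
  exact isBridge_iff.2 fun hr => hC.notMem (hC.branch_subset hr)

end EdgeCut

variable {V : Type u} {P : Set V → Prop}

/-- A connected graph all of whose edges are bridges, with `m t` half-edges at the node `t`, whose
degrees, counting half-edges, are one and three, and whose nodes of degree one are the images of
the vertices in `A`. Every edge has a side without half-edges that holds a set with `P`. -/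
structure IsStubTree (P : Set V → Prop) (A : Set V) {N : Type*} (T : SimpleGraph N) (m : N → ℕ)
    (φ : V → N) : Prop where
  connected : T.Connected
  injOn : A.InjOn φ
  degree : ∀ t, (T.neighborSet t).ncard + m t = 1 ∨ (T.neighborSet t).ncard + m t = 3
  mem_image_iff : ∀ t, t ∈ φ '' A ↔ (T.neighborSet t).ncard + m t = 1
  cut : ∀ x y, T.Adj x y → ∃ C, (T.IsEdgeCut x y C ∨ T.IsEdgeCut y x C) ∧
    (∀ c ∈ C, m c = 0) ∧ P (A ∩ φ ⁻¹' C)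

theorem IsStubTree.congr {A : Set V} {N : Type*} {T : SimpleGraph N} {m m' : N → ℕ} {φ : V → N}
    (h : IsStubTree P A T m φ) (hm : ∀ t, m t = m' t) : IsStubTree P A T m' φ :=
  funext hm ▸ h

theorem isStubTree_unit_singleton (v : V) :
    IsStubTree P {v} (⊥ : SimpleGraph Unit) (Pi.single () 1) (fun _ => ()) where
  connected := IsTree.of_subsingleton.connected
  injOn := by simp
  degree := by simp
  mem_image_iff := by simp
  cut := by simp

theorem isStubTree_unit_empty :
    IsStubTree P (∅ : Set V) (⊥ : SimpleGraph Unit) (Pi.single () 3) (fun _ => ()) where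
  connected := IsTree.of_subsingleton.connected
  injOn := by simp
  degree := by simp
  mem_image_iff := by simp
  cut := by simp

section Attach

variable {N M : Type*} {T : SimpleGraph N} {U : SimpleGraph M} {a : N} {r : M}

theorem IsEdgeCut.glue_inl {x y : N} {C : Set N} (h : T.IsEdgeCut x y C) (ha : a ∉ C) :
    (T.glue U a r).IsEdgeCut (.inl x) (.inl y) (Sum.inl '' C) where
  mem := Set.mem_image_of_mem _ h.mem
  notMem := by simpa using h.notMem
  eq_of_adj := by
    rintro _ ⟨c, hc, rfl⟩ (b | b) hb hab
    · simpa using h.eq_of_adj c hc b (by simpa using hb) hab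
    · exact absurd (hab.1 ▸ hc) ha

theorem IsEdgeCut.glue_inr {x y : M} {C : Set M} (h : U.IsEdgeCut x y C) (hr : r ∉ C) :
    (T.glue U a r).IsEdgeCut (.inr x) (.inr y) (Sum.inr '' C) where
  mem := Set.mem_image_of_mem _ h.mem
  notMem := by simpa using h.notMem
  eq_of_adj := by
    rintro _ ⟨c, hc, rfl⟩ (b | b) hb hab
    · exact absurd (hab.2 ▸ hc) hr
    · simpa using h.eq_of_adj c hc b (by simpa using hb) hab

theorem isEdgeCut_glue : (T.glue U a r).IsEdgeCut (.inr r) (.inl a) (Set.range Sum.inr) where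
  mem := Set.mem_range_self _
  notMem := by simp
  eq_of_adj := by
    rintro _ ⟨c, rfl⟩ (b | b) hb hab
    · exact ⟨congrArg _ hab.2, congrArg _ hab.1⟩
    · simp at hb

-- The new edge uses up a half-edge at `a` and the one at `r`, so degrees counting half-edges do not
-- change. The side of `U` then has no half-edge left and holds exactly `B`. For an old edge, the
-- side free of half-edges misses `a` or `r`, so the new edge does not leave it.
open Classical in
theorem IsStubTree.attach [Finite N] [Finite M] {A B : Set V} {m : N → ℕ} {φ : V → N} {ψ : V → M}
    (hT : IsStubTree P A T m φ) (ha : m a ≠ 0) (hU : IsStubTree P B U (Pi.single r 1) ψ)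
    (hAB : Disjoint A B) (hB : P B) :
    IsStubTree P (A ∪ B) (T.glue U a r) (Sum.elim (m - Pi.single a 1) 0)
      (fun v => if v ∈ B then .inr (ψ v) else .inl (φ v)) := by
  have hinl : ∀ C : Set N, (A ∪ B) ∩ (fun v => if v ∈ B then Sum.inr (ψ v) else Sum.inl (φ v)) ⁻¹'
      (Sum.inl '' C : Set (N ⊕ M)) = A ∩ φ ⁻¹' C := by
    intro C
    ext v
    by_cases hv : v ∈ B
    · simp [hv, Set.disjoint_right.1 hAB hv]
    · simp [hv]
  have hinr : ∀ C : Set M, (A ∪ B) ∩ (fun v => if v ∈ B then Sum.inr (ψ v) else Sum.inl (φ v)) ⁻¹'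
      (Sum.inr '' C : Set (N ⊕ M)) = B ∩ ψ ⁻¹' C := by
    intro C
    ext v
    by_cases hv : v ∈ B <;> simp [hv]
  have hdegl : ∀ x, ((T.glue U a r).neighborSet (.inl x)).ncard + (m - Pi.single a 1 : N → ℕ) x =
      (T.neighborSet x).ncard + m x := by
    intro x
    rw [ncard_neighborSet_glue_inl, Pi.sub_apply, add_assoc]
    by_cases hx : x = a
    · subst hx
      rw [Pi.single_eq_same]
      omega
    · simp [hx]
  have hcutl : ∀ C : Set N, (∀ c ∈ C, m c = 0) → a ∉ C := fun C hC h => ha (hC a h)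
  have hcutr : ∀ C : Set M, (∀ c ∈ C, (Pi.single r 1 : M → ℕ) c = 0) → r ∉ C :=
    fun C hC h => by simpa using hC r h
  have hlink : ∃ C, (T.glue U a r).IsEdgeCut (.inr r) (.inl a) C ∧
      (∀ c ∈ C, (Sum.elim (m - Pi.single a 1) 0 : N ⊕ M → ℕ) c = 0) ∧
      P ((A ∪ B) ∩ (fun v => if v ∈ B then Sum.inr (ψ v) else Sum.inl (φ v)) ⁻¹' C) := by
    refine ⟨_, isEdgeCut_glue, by rintro _ ⟨c, rfl⟩; rfl, ?_⟩
    rw [← Set.image_univ, hinr]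
    simpa using hB
  refine ⟨hT.connected.glue hU.connected, ?_, ?_, ?_, ?_⟩
  · intro u hu v hv huv
    by_cases huB : u ∈ B <;> by_cases hvB : v ∈ B <;> simp only [huB, hvB, if_true, if_false] at huv
    · exact hU.injOn huB hvB (Sum.inr_injective huv)
    · cases huv
    · cases huv
    · exact hT.injOn (hu.resolve_right huB) (hv.resolve_right hvB) (Sum.inl_injective huv)
  · rintro (x | x)
    · rw [Sum.elim_inl, hdegl]
      exact hT.degree x
    · rw [ncard_neighborSet_glue_inr]
      exact hU.degree x
  · rintro (x | x)
    · rw [Sum.elim_inl, hdegl, ← hT.mem_image_iff x]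
      constructor
      · rintro ⟨v, hv, h⟩
        by_cases hvB : v ∈ B <;> simp only [hvB, if_true, if_false] at h
        · cases h
        · exact ⟨v, hv.resolve_right hvB, Sum.inl_injective h⟩
      · rintro ⟨v, hv, rfl⟩
        exact ⟨v, Or.inl hv, if_neg (Set.disjoint_left.1 hAB hv)⟩
    · rw [ncard_neighborSet_glue_inr, Sum.elim_inr, Pi.zero_apply, add_zero, ← hU.mem_image_iff x]
      constructor
      · rintro ⟨v, -, h⟩
        by_cases hvB : v ∈ B <;> simp only [hvB, if_true, if_false] at h
        · exact ⟨v, hvB, Sum.inr_injective h⟩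
        · cases h
      · rintro ⟨v, hv, rfl⟩
        exact ⟨v, Or.inr hv, if_pos hv⟩
  · rintro (x | x) (y | y) hxy
    · obtain ⟨C, hC, hm, hP⟩ := hT.cut x y hxy
      refine ⟨Sum.inl '' C, hC.imp (·.glue_inl (hcutl C hm)) (·.glue_inl (hcutl C hm)), ?_, ?_⟩
      · rintro _ ⟨c, hc, rfl⟩
        simp [hm c hc]
      · rwa [hinl]
    · obtain ⟨rfl, rfl⟩ := hxy
      obtain ⟨C, hC, h⟩ := hlink
      exact ⟨C, Or.inr hC, h⟩
    · obtain ⟨rfl, rfl⟩ := hxy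
      obtain ⟨C, hC, h⟩ := hlink
      exact ⟨C, Or.inl hC, h⟩
    · obtain ⟨C, hC, hm, hP⟩ := hU.cut x y hxy
      refine ⟨Sum.inr '' C, hC.imp (·.glue_inr (hcutr C hm)) (·.glue_inr (hcutr C hm)), ?_, ?_⟩
      · rintro _ ⟨c, hc, rfl⟩
        rfl
      · rwa [hinr]

end Attach

/-! ### From assembled sets to decomposition trees -/

open Classical in
theorem Assembles.exists_isStubTree {A : Set V} (h : Assembles P A) :
    ∃ (N : Type) (_ : Finite N) (T : SimpleGraph N) (r : N) (φ : V → N),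
      IsStubTree P A T (Pi.single r 1) φ := by
  induction h with
  | singleton v _ =>
    refine ⟨Unit, inferInstance, ⊥, (), fun _ => (), ?_⟩
    convert isStubTree_unit_singleton v
  | @union A B hA hB hAB _ ihA ihB =>
    obtain ⟨N, _, T, r, φ, hT⟩ := ihA
    obtain ⟨M, _, U, s, ψ, hU⟩ := ihB
    -- A new node with three half-edges receives both roots; its third half-edge is the new root.
    have h1 := (isStubTree_unit_empty (P := P)).attach (a := ()) (by simp) hT
      (Set.empty_disjoint A) hA.prop
    have h2 := h1.attach (a := Sum.inl ()) (by simp) hU (by rwa [Set.empty_union]) hB.prop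
    rw [Set.empty_union] at h2
    refine ⟨_, inferInstance, _, Sum.inl (Sum.inl ()), _, h2.congr ?_⟩
    rintro ((z | z) | z) <;> simp

theorem exists_decompositionTree {N : Type} [Finite N] {T : SimpleGraph N} (hT : T.Connected)
    {φ : V → N} (hφ : φ.Injective)
    (hdeg : ∀ t, ¬ T.IsLeafNode t → (T.neighborSet t).ncard = 3)
    (hleaf : ∀ t, t ∈ Set.range φ ↔ T.IsLeafNode t)
    (hcut : ∀ x y, T.Adj x y → ∃ C, (T.IsEdgeCut x y C ∨ T.IsEdgeCut y x C) ∧ P (φ ⁻¹' C)) :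
    ∃ D : DecompositionTree V, ∀ e, P (D.side e) ∨ P (D.side e)ᶜ := by
  have htree : T.IsTree := hT.isTree_of_isEdgeCut fun x y h => by
    obtain ⟨C, hC | hC, -⟩ := hcut x y h
    exacts [⟨_, hC⟩, ⟨_, hC.compl⟩]
  refine ⟨⟨N, inferInstance, T, htree, hdeg, (Equiv.ofInjective φ hφ).trans
    (Equiv.subtypeEquivRight hleaf)⟩, fun e => ?_⟩
  obtain ⟨⟨x, y⟩, hxy⟩ := e
  obtain ⟨C, hC | hC, hP⟩ := hcut x y hxy
  · left
    rwa [← hC.branch_eq hT] at hP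
  · right
    rw [← compl_compl C, ← hC.compl.branch_eq hT] at hP
    exact hP

theorem Assembles.exists_decompositionTree (h : Assembles P (Set.univ : Set V)) :
    ∃ D : DecompositionTree V, ∀ e, P (D.side e) ∨ P (D.side e)ᶜ := by
  classical
  generalize hX : (Set.univ : Set V) = X at h
  cases h with
  | singleton v _ =>
    have hsub : Subsingleton V := Set.subsingleton_univ_iff.1 (hX ▸ Set.subsingleton_singleton)
    refine SimpleGraph.exists_decompositionTree (T := (⊥ : SimpleGraph Unit)) (φ := fun _ => ())
      IsTree.of_subsingleton.connected (Function.injective_of_subsingleton _) ?_ ?_ ?_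
    · simp [IsLeafNode]
    · exact fun t => iff_of_true ⟨v, rfl⟩ (by simp [IsLeafNode])
    · simp
  | @union A B hA hB hAB _ =>
    obtain ⟨N, _, T, r, φ, hT⟩ := hA.exists_isStubTree
    obtain ⟨M, _, U, s, ψ, hU⟩ := hB.exists_isStubTree
    -- At the top the two roots are joined directly, since a new node between them would have degree
    -- two. No half-edge remains.
    have h := hT.attach (a := r) (by simp) hU hAB hB.prop
    rw [← hX, tsub_self] at h
    have hzero : ∀ z, (Sum.elim 0 0 : N ⊕ M → ℕ) z = 0 := by rintro (z | z) <;> rfl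
    have hdeg := h.degree
    have himage := h.mem_image_iff
    have hcut := h.cut
    simp only [hzero, add_zero, Set.image_univ, Set.univ_inter] at hdeg himage hcut
    have hiff : ∀ t, (T.glue U r s).IsLeafNode t ↔ ((T.glue U r s).neighborSet t).ncard = 1 :=
      fun t => ⟨fun ht => (hdeg t).resolve_right fun h3 => by
        rw [IsLeafNode] at ht; omega, fun ht => ht.le⟩
    refine SimpleGraph.exists_decompositionTree h.connected (Set.injOn_univ.1 h.injOn) ?_ ?_ ?_
    · exact fun t ht => (hdeg t).resolve_left fun h1 => ht h1.le
    · exact fun t => (himage t).trans (hiff t).symm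
    · exact fun x y hxy => (hcut x y hxy).imp fun C hC => ⟨hC.1, hC.2.2⟩

/-! ### Conclusion of both inequalities -/

variable {G : SimpleGraph V}

theorem exists_treeDecomposition_width_eq (G : SimpleGraph V) :
    ∃ D : G.TreeDecomposition, D.width = G.treewidth := by
  have : Nonempty G.TreeDecomposition :=
    ⟨⟨Unit, inferInstance, ⊥, IsTree.of_subsingleton, fun _ => Set.univ, fun _ => ⟨(), trivial⟩,
      fun _ _ _ => ⟨(), trivial, trivial⟩, fun _ _ _ => .of_subsingleton⟩⟩
  exact Nat.sInf_mem (Set.range_nonempty fun D : G.TreeDecomposition => D.width)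

theorem TreeDecomposition.ncard_bag_le (D : G.TreeDecomposition) (t : D.Node) :
    (D.bag t).ncard ≤ D.width + 1 := by
  have := D.finite_node
  have h : (D.bag t).ncard ≤ ⨆ t, (D.bag t).ncard :=
    le_ciSup (f := fun t => (D.bag t).ncard) (Set.finite_range _).bddAbove t
  exact h.trans (Nat.sub_le_iff_le_add.1 le_rfl)

theorem exists_decompositionTree_width_le [Finite V] [Nonempty V] (G : SimpleGraph V) :
    ∃ D : DecompositionTree V, D.width G.cutBool ≤ (G.treewidth : ℝ) + 1 := by
  obtain ⟨D, hD⟩ := G.exists_treeDecomposition_width_eq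
  obtain ⟨E, hE⟩ := (D.assembles_univ (k := G.treewidth + 1) (fun t => hD ▸ D.ncard_bag_le t)
    (Nat.le_add_left 1 _)).exists_decompositionTree
  refine ⟨E, Real.iSup_le (fun e => ?_) (by positivity)⟩
  -- The tree controls only one side of each edge, but covering a cut is symmetric under complement.
  obtain ⟨S, hS, hcov⟩ : ∃ S : Set V, S.ncard ≤ G.treewidth + 1 ∧ G.CoversCut (E.side e) S := by
    rcases hE e with h | ⟨S, hS, hcov⟩
    · exact h
    · exact ⟨S, hS, compl_compl (E.side e) ▸ hcov.compl⟩
  exact hcov.cutBool_le.trans (by exact_mod_cast hS)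

end SimpleGraph

theorem theorem2 {V : Type*} [Fintype V] [Nonempty V] (G : SimpleGraph V) [DecidableRel G.Adj]
    (d : ℕ) (hd : G.maxDegree = d) :
    (G.treewidth : ℝ) ≤ 6 * (d : ℝ) ^ 2 * G.booleanWidth ∧
      G.booleanWidth ≤ (G.treewidth : ℝ) + 1 := by
  obtain ⟨D, hD⟩ := G.exists_decompositionTree_width_le
  have hdeg : ∀ v, (G.neighborSet v).ncard ≤ d := fun v => by
    rw [Set.ncard_eq_toFinset_card', ← hd]
    exact G.degree_le_maxDegree v
  constructor
  · have : Nonempty (SimpleGraph.DecompositionTree V) := ⟨D⟩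
    rw [SimpleGraph.booleanWidth, SimpleGraph.fWidth, Real.mul_iInf_of_nonneg (by positivity)]
    refine le_ciInf fun E => (E.treewidth_le hdeg).trans ?_
    -- Nonnegativity allows the constant 3 to be weakened to 6.
    have := mul_nonneg (sq_nonneg (d : ℝ)) (E.width_nonneg (G := G))
    linarith
  · refine (ciInf_le ⟨0, ?_⟩ D).trans hD
    rintro _ ⟨E, rfl⟩
    exact E.width_nonneg
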